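/- Let $n \ge 1$ and $N = 2^n$. Let $G_2 = \begin{pmatrix} 1 & 0 \\ 1 & 1 \end{pmatrix}$ over $\mathbb{F}_2$ and $G_N = G_2^{\otimes n}$, and let $W$ be a binary-input discrete memoryless channel with positive symmetric capacity $\mathcal{I}(W) > 0$ (the symmetric capacity is the mutual information between a uniform input bit and the output). For a puncturing pattern $P \in \{0,1\}^N$ and $0 \le i \le N-1$, let $W[P]_N^{(i)}$ be the virtual channel with input $u_i$ and output $(y_0^{N-1}, u_0^{i-1})$, where the data bits other than $u_i$ are independent and uniform, $x_0^{N-1} = u_0^{N-1} G_N$, the symbols $y_j$ are conditionally independent given $x_0^{N-1}$, and $y_j$ is the output of $W$ on input $x_j$ if $P(j) = 0$, while $y_j = \star$ (a fixed extra erasure symbol) if $P(j) = 1$. The erasure pattern $E[P] \in \{0,1\}^N$ is defined by $E[P](i) = 1$ if and only if $\mathcal{I}(W[P]_N^{(i)}) = 0$, and $P$ is called symmetric if $E[P] = P$; the same definitions apply to patterns of length $N/2 = 2^{n-1}$ (with $G_1 = (1)$). For $M$ a power of $2$, let $B_M$ be the bit-reversal permutation of $\{0, \dots, M-1\}$, acting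 on vectors of length $M$ by $B_M(A)(i) = A(B_M(i))$. For binary vectors, $A \subseteq B$ means $A \vee B = B$ bitwise. Theorem (recursive characterization of symmetric patterns). Let $P \in \{0,1\}^N$, $\bar P = B_N(P)$, $\bar P_0 = [\bar P(0), \dots, \bar P(N/2-1)]$ and $\bar P_1 = [\bar P(N/2), \dots, \bar P(N-1)]$. Then $P$ is symmetric if and only if $B_{N/2}(\bar P_0)$ and $B_{N/2}(\bar P_1)$ are both symmetric and $\bar P_1 \subseteq \bar P_0$. -/

import Mathlib

namespace PolarPuncturing

open scoped BigOperators

/-! ### Binary vectors and bit reversal -/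

/-- Binary vectors of length `N`; a puncturing pattern `P` punctures position `i` iff `P i = true`. -/
abbrev Pattern (N : ℕ) : Type := Fin N → Bool

/-- The bit-reversal permutation of `{0, …, 2 ^ n - 1}`: write `i` with `n` binary digits, reverse
the order of the digits, and read the result as a number. -/
def bitReversal (n : ℕ) : Equiv.Perm (Fin (2 ^ n)) :=
  (finFunctionFinEquiv (m := 2) (n := n)).symm.trans
    ((Equiv.arrowCongr Fin.revPerm (Equiv.refl (Fin 2))).trans finFunctionFinEquiv)

/-- Action of a permutation on a vector: `φ(A)(i) = A(φ(i))`. -/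
def permute {N : ℕ} (φ : Equiv.Perm (Fin N)) (A : Pattern N) : Pattern N := fun i => A (φ i)

/-- `[A(0), …, A(N/2 - 1)]` for `N = 2 ^ (n + 1)`. -/
def firstHalf {n : ℕ} (A : Pattern (2 ^ (n + 1))) : Pattern (2 ^ n) :=
  fun i => A ⟨i, by have := i.isLt; rw [pow_succ]; omega⟩

/-- `[A(N/2), …, A(N - 1)]` for `N = 2 ^ (n + 1)`. -/
def secondHalf {n : ℕ} (A : Pattern (2 ^ (n + 1))) : Pattern (2 ^ n) :=
  fun i => A ⟨2 ^ n + i, by have := i.isLt; rw [pow_succ]; omega⟩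

/-- Bitwise inclusion `A ⊆ B` of binary vectors: `A ∨ B = B`. -/
def BitIncluded {N : ℕ} (A B : Pattern N) : Prop := (fun i => A i || B i) = B

/-! ### The generator matrix -/

/-- The polar kernel. -/
def kernelMatrix : Matrix (Fin 2) (Fin 2) (ZMod 2) := !![1, 0; 1, 1]

/-- The pair `(a, j)` corresponds to the index `a * 2 ^ n + j`. -/
def blockEquiv (n : ℕ) : Fin 2 × Fin (2 ^ n) ≃ Fin (2 ^ (n + 1)) :=
  finProdFinEquiv.trans (finCongr (pow_succ' 2 n).symm)

/-- The generator matrix of size `N = 2 ^ n`: the `n`-th Kronecker power of the kernel. -/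
def generatorMatrix : (n : ℕ) → Matrix (Fin (2 ^ n)) (Fin (2 ^ n)) (ZMod 2)
  | 0 => 1
  | n + 1 => Matrix.reindex (blockEquiv n) (blockEquiv n)
      (Matrix.kronecker kernelMatrix (generatorMatrix n))

/-! ### Channels -/

/-- A binary-input discrete memoryless channel with output alphabet `Y`: for each input bit `x`, a
discrete probability distribution `W(· | x)` on `Y`. -/
abbrev BDMC (Y : Type*) := ZMod 2 → PMF Y

/-- The symmetric capacity: the mutual information, in bits, between a uniform input bit and the
output,
`I(W) = ∑_y ∑_x (1/2) W(y|x) log₂ (W(y|x) / ((1/2) W(y|0) + (1/2) W(y|1)))`. -/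
noncomputable def symmetricCapacity {Y : Type*} (W : BDMC Y) : ℝ :=
  ∑' y, ∑ x : ZMod 2, (1 / 2 : ℝ) * (W x y).toReal *
    Real.logb 2 ((W x y).toReal / ((1 / 2 : ℝ) * (W 0 y).toReal + (1 / 2 : ℝ) * (W 1 y).toReal))

/-- The series defining the symmetric capacity always converges absolutely. -/
theorem summable_symmetricCapacity {Y : Type*} (W : BDMC Y) :
    Summable fun y => ∑ x : ZMod 2, (1 / 2 : ℝ) * (W x y).toReal *
      Real.logb 2
        ((W x y).toReal / ((1 / 2 : ℝ) * (W 0 y).toReal + (1 / 2 : ℝ) * (W 1 y).toReal)) := by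
  have hs : ∀ x : ZMod 2, Summable fun y => (W x y).toReal :=
    fun x => ENNReal.summable_toReal (W x).tsum_coe_ne_top
  have key : ∀ a m : ℝ, 0 ≤ a → 0 ≤ m → a ≤ 2 * m →
      |a * Real.log (a / m)| ≤ a + m := by
    intro a m ha hm ham
    rcases ha.eq_or_lt with rfl | ha
    · simpa using hm
    have hm' : 0 < m := by linarith
    have h1 : Real.log (a / m) ≤ 1 := by
      have h2 : a / m ≤ 2 := (div_le_iff₀ hm').2 ham
      have h3 := Real.log_le_sub_one_of_pos (div_pos ha hm')
      linarith
    have h4 : 1 - m / a ≤ Real.log (a / m) := by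
      have := Real.one_sub_inv_le_log_of_pos (div_pos ha hm')
      rwa [inv_div] at this
    have h5 : a * (1 - m / a) = a - m := by field_simp
    have h6 := mul_le_mul_of_nonneg_left h4 ha.le
    have h7 := mul_le_mul_of_nonneg_left h1 ha.le
    rw [abs_le]
    constructor <;> linarith
  refine summable_sum fun x _ => ?_
  refine Summable.of_norm_bounded
    (g := fun y => (1 / 2 / Real.log 2) * ((W x y).toReal +
      ((1 / 2 : ℝ) * (W 0 y).toReal + (1 / 2 : ℝ) * (W 1 y).toReal))) ?_ ?_
  · exact ((hs x).add (((hs 0).mul_left _).add ((hs 1).mul_left _))).mul_left _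
  · intro y
    have hl : 0 < Real.log 2 := Real.log_pos (by norm_num)
    have h0 : 0 ≤ (W 0 y).toReal := ENNReal.toReal_nonneg
    have h1 : 0 ≤ (W 1 y).toReal := ENNReal.toReal_nonneg
    have hx : (W x y).toReal ≤
        2 * ((1 / 2 : ℝ) * (W 0 y).toReal + (1 / 2 : ℝ) * (W 1 y).toReal) := by
      fin_cases x
      · change (W 0 y).toReal ≤ _
        linarith
      · change (W 1 y).toReal ≤ _
        linarith
    have hk := key _ _ ENNReal.toReal_nonneg (by positivity) hx
    have he : ∀ a b : ℝ, (1 / 2 : ℝ) * a * Real.logb 2 b =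
        (1 / 2 / Real.log 2) * (a * Real.log b) := by
      intro a b
      rw [Real.logb]
      ring
    rw [he, Real.norm_eq_abs, abs_mul, abs_of_pos (by positivity)]
    exact mul_le_mul_of_nonneg_left hk (by positivity)

/-- The law of `N` independent outputs, the `j`-th one distributed according to `p j`. -/
noncomputable def productLaw {Z : Type*} {N : ℕ} (p : Fin N → PMF Z) : PMF (Fin N → Z) :=
  ⟨fun z => ∏ j, p j (z j), by
    have h : ∑' z : Fin N → Z, ∏ j, p j (z j) = 1 := by
      induction N with
      | zero => simp
      | succ N ih =>
        rw [← (Fin.consEquiv fun _ : Fin (N + 1) => Z).tsum_eq, ENNReal.tsum_prod']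
        simp only [Fin.consEquiv, Equiv.coe_fn_mk, Fin.prod_univ_succ, Fin.cons_zero,
          Fin.cons_succ, ENNReal.tsum_mul_left]
        simp only [ih fun j => p j.succ, mul_one, PMF.tsum_coe]
    exact h ▸ ENNReal.summable.hasSum⟩

/-- The channel seen by position `j` of the codeword. The output alphabet is extended by the symbol
`⋆ = none`; a punctured position always outputs `⋆`, the others use `W`. -/
noncomputable def puncturedChannel {Y : Type*} (W : BDMC Y) {N : ℕ} (P : Pattern N) (j : Fin N) :
    BDMC (Option Y) :=
  fun x => if P j = true then PMF.pure none else (W x).map some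

/-- The virtual channel `W[P]_N^{(i)}` with input `u_i` and output `(y[P]_0^{N-1}, u_0^{i-1})`,
for `N = 2 ^ n`: all data bits other than `u_i` are uniform and independent, the codeword
`x = u · G_N` is sent position by position through the punctured channels, and the receiver sees
all `N` outputs together with the data bits preceding `u_i`. -/
noncomputable def virtualChannel {Y : Type*} (W : BDMC Y) {n : ℕ} (P : Pattern (2 ^ n))
    (i : Fin (2 ^ n)) : BDMC ((Fin (2 ^ n) → Option Y) × (Fin i → ZMod 2)) :=
  fun b =>
    (PMF.uniformOfFintype (Fin (2 ^ n) → ZMod 2)).bind fun v =>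
      let u : Fin (2 ^ n) → ZMod 2 := Function.update v i b
      let x : Fin (2 ^ n) → ZMod 2 := Matrix.vecMul u (generatorMatrix n)
      (productLaw fun j => puncturedChannel W P j (x j)).map fun y =>
        (y, fun k : Fin i => u ⟨k, k.isLt.trans i.isLt⟩)

/-! ### Erasure patterns and symmetric patterns -/

open Classical in
/-- The data bit erasure pattern `E[P]`: `E[P](i) = 1` iff the virtual channel `W[P]_N^{(i)}` has
symmetric capacity zero. -/
noncomputable def erasurePattern {Y : Type*} (W : BDMC Y) {n : ℕ} (P : Pattern (2 ^ n)) :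
    Pattern (2 ^ n) :=
  fun i => decide (symmetricCapacity (virtualChannel W P i) = 0)

/-- A puncturing pattern is symmetric if it equals its erasure pattern. -/
def IsSymmetricPattern {Y : Type*} (W : BDMC Y) {n : ℕ} (P : Pattern (2 ^ n)) : Prop :=
  erasurePattern W P = P

end PolarPuncturing

open PolarPuncturing

open PolarPuncturing

namespace PolarPuncturing

/-! ### Vanishing of the symmetric capacity -/

/-! Erasure is a matter of linear algebra over `ZMod 2`. Capacity vanishes exactly when both inputs
have the same output law, so `W 0 ≠ W 1`. Position `i` is then erased iff some `w` with leading
position `i` has its codeword supported on punctured positions (`erasurePattern_iff`). Translation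
by such a `w` exchanges the two inputs invisibly. If there is none, `u i` is a combination of
earlier bits and unpunctured code symbols, and a character argument separates the two inputs.

The Kronecker structure turns a split on the most significant digit into OR and AND of the two half
patterns. By induction, a split on the least significant digit gives E[P](2i) = E[P₀](i) ∨ E[P₁](i)
and E[P](2i+1) = E[P₀](i) ∧ E[P₁](i), where P₀ and P₁ are the even and odd parts of P
(`isErased_interleave`). Bit reversal carries the halves of the reversed pattern to these parts.
Since AND implies OR, symmetry of P forces P₁ ⊆ P₀; erasure is monotone in the pattern, so OR and
AND reduce to E[P₀] and E[P₁]. -/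

theorem mul_log_div_ge {a m : ℝ} (ha : 0 ≤ a) (hm : 0 < m) : a - m ≤ a * Real.log (a / m) := by
  rcases ha.eq_or_lt with rfl | ha
  · simpa using hm.le
  have h := Real.one_sub_inv_le_log_of_pos (div_pos ha hm)
  rw [inv_div] at h
  have h5 : a * (1 - m / a) = a - m := by field_simp
  have := mul_le_mul_of_nonneg_left h ha.le
  linarith

theorem mul_log_div_gt {a m : ℝ} (ha : 0 ≤ a) (hm : 0 < m) (hne : a ≠ m) :
    a - m < a * Real.log (a / m) := by
  rcases ha.eq_or_lt with rfl | ha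
  · simpa using hm
  have h := Real.log_lt_sub_one_of_pos (div_pos hm ha)
    (by rw [Ne, div_eq_one_iff_eq ha.ne']; exact hne.symm)
  rw [← inv_div, Real.log_inv, inv_div] at h
  have h5 : a * (m / a - 1) = m - a := by field_simp
  have := mul_lt_mul_of_pos_left h ha
  linarith

/-- The summand of the symmetric capacity. -/
noncomputable def capacityTerm (a b : ℝ) : ℝ :=
  (1 / 2) * a * Real.logb 2 (a / (1 / 2 * a + 1 / 2 * b)) +
    (1 / 2) * b * Real.logb 2 (b / (1 / 2 * a + 1 / 2 * b))

theorem capacityTerm_eq (a b : ℝ) :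
    capacityTerm a b = (1 / 2 / Real.log 2) * (a * Real.log (a / (1 / 2 * a + 1 / 2 * b)) +
      b * Real.log (b / (1 / 2 * a + 1 / 2 * b))) := by
  unfold capacityTerm Real.logb
  ring

theorem capacityTerm_self (a : ℝ) : capacityTerm a a = 0 := by
  rw [capacityTerm_eq]
  rcases eq_or_ne a 0 with rfl | h
  · simp
  · have : 1 / 2 * a + 1 / 2 * a = a := by ring
    rw [this, div_self h]
    simp

/-- With m the midpoint of a and b, the lower bounds a - m and b - m cancel, and the first is strict
because a ≠ m. -/
theorem capacityTerm_pos {a b : ℝ} (ha : 0 ≤ a) (hb : 0 ≤ b) (hab : a ≠ b) :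
    0 < capacityTerm a b := by
  rw [capacityTerm_eq]
  have hl : 0 < Real.log 2 := Real.log_pos (by norm_num)
  have hm : 0 < 1 / 2 * a + 1 / 2 * b := by
    rcases ha.eq_or_lt with rfl | ha
    · have := hb.lt_of_ne hab
      linarith
    · linarith
  have h1 := mul_log_div_gt ha hm (fun h => hab (by linarith))
  have h2 := mul_log_div_ge hb hm
  refine mul_pos (by positivity) (by linarith)

theorem capacityTerm_nonneg {a b : ℝ} (ha : 0 ≤ a) (hb : 0 ≤ b) : 0 ≤ capacityTerm a b := by
  rcases eq_or_ne a b with rfl | h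
  · exact (capacityTerm_self a).ge
  · exact (capacityTerm_pos ha hb h).le

theorem sum_zmod_two {M : Type*} [AddCommMonoid M] (f : ZMod 2 → M) : ∑ x, f x = f 0 + f 1 :=
  Fin.sum_univ_two f

/-- The terms are nonnegative and vanish only where the two probabilities agree. Summability
matters: a divergent `tsum` would be 0 by default. -/
theorem symmetricCapacity_eq_zero_iff {Y : Type*} (W : BDMC Y) :
    symmetricCapacity W = 0 ↔ W 0 = W 1 := by
  have hs : Summable fun y => capacityTerm (W 0 y).toReal (W 1 y).toReal := by
    have := summable_symmetricCapacity W
    simp only [sum_zmod_two] at this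
    exact this
  have he : symmetricCapacity W = ∑' y, capacityTerm (W 0 y).toReal (W 1 y).toReal := by
    unfold symmetricCapacity
    simp only [sum_zmod_two]
    rfl
  rw [he]
  constructor
  · contrapose!
    intro hne
    obtain ⟨y, hy⟩ : ∃ y, W 0 y ≠ W 1 y := by
      by_contra! h
      exact hne (PMF.ext h)
    refine (hs.tsum_pos (fun y => ?_) y ?_).ne'
    · exact capacityTerm_nonneg ENNReal.toReal_nonneg ENNReal.toReal_nonneg
    · refine capacityTerm_pos ENNReal.toReal_nonneg ENNReal.toReal_nonneg fun h => hy ?_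
      exact (ENNReal.toReal_eq_toReal_iff' ((W 0).apply_ne_top y) ((W 1).apply_ne_top y)).1 h
  · intro h
    simp [h, capacityTerm_self]

/-! ### Linear characterization of the erasure pattern -/

/-- Some data vector with leading position `i` is encoded to a word supported on the punctured
positions. -/
def IsErased {n : ℕ} (P : Pattern (2 ^ n)) (i : Fin (2 ^ n)) : Prop :=
  ∃ w : Fin (2 ^ n) → ZMod 2, (∀ k < i, w k = 0) ∧ w i = 1 ∧
    ∀ j, P j = false → Matrix.vecMul w (generatorMatrix n) j = 0

theorem IsErased.mono {n : ℕ} {P Q : Pattern (2 ^ n)} (h : ∀ j, P j = true → Q j = true)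
    {i : Fin (2 ^ n)} (hi : IsErased P i) : IsErased Q i := by
  obtain ⟨w, h1, h2, h3⟩ := hi
  refine ⟨w, h1, h2, fun j hj => h3 j ?_⟩
  specialize h j
  revert h
  cases P j <;> simp [hj]

/-- A uniform vector is invariant under translation. -/
theorem uniform_bind_add {G α : Type*} [AddGroup G] [Fintype G] (w : G)
    (f : G → PMF α) :
    ((PMF.uniformOfFintype G).bind fun v => f (v + w)) = (PMF.uniformOfFintype G).bind f := by
  ext a
  simp only [PMF.bind_apply, PMF.uniformOfFintype_apply]
  exact (Equiv.addRight w).tsum_eq fun v => (Fintype.card G : ENNReal)⁻¹ * f v a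

/-- Adding `w` to the uniform data flips bit `i` but changes neither the earlier bits nor any
unpunctured code symbol. -/
theorem virtualChannel_eq_of_isErased {Y : Type*} (W : BDMC Y) {n : ℕ} {P : Pattern (2 ^ n)}
    {i : Fin (2 ^ n)} (h : IsErased P i) : virtualChannel W P i 0 = virtualChannel W P i 1 := by
  obtain ⟨w, h1, h2, h3⟩ := h
  unfold virtualChannel
  conv_rhs => rw [← uniform_bind_add w]
  congr 1
  funext v
  have hu : Function.update (v + w) i 1 = Function.update v i 0 + w := by
    funext k
    rcases eq_or_ne k i with rfl | hk
    · simp [h2]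
    · simp [hk]
  simp only [hu, Matrix.add_vecMul]
  congr 1
  · funext y
    congr 1
    funext k
    simp [h1 ⟨k, k.isLt.trans i.isLt⟩ k.isLt]
  · congr 1
    funext j
    unfold puncturedChannel
    by_cases hj : P j = true
    · simp [hj]
    · simp [h3 j (by simpa using hj)]

/-- The nontrivial real character of `ZMod 2`. -/
noncomputable def sign (x : ZMod 2) : ℝ := if x = 0 then 1 else -1

theorem sign_zero : sign 0 = 1 := by simp [sign]

theorem sign_one : sign 1 = -1 := by simp [sign]

theorem sign_add (x y : ZMod 2) : sign (x + y) = sign x * sign y := by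
  have two : ∀ x : ZMod 2, x = 0 ∨ x = 1 := by decide
  rcases two x with rfl | rfl <;> rcases two y with rfl | rfl <;>
    simp [sign_zero, sign_one, show (1 + 1 : ZMod 2) = 0 by decide]

theorem sign_sum {ι : Type*} (s : Finset ι) (f : ι → ZMod 2) :
    sign (∑ j ∈ s, f j) = ∏ j ∈ s, sign (f j) := by
  classical
  induction s using Finset.induction_on with
  | empty => simp [sign_zero]
  | insert a s ha ih => rw [Finset.sum_insert ha, Finset.prod_insert ha, sign_add, ih]

theorem exists_lt_of_pmf_ne {Y : Type*} {p q : PMF Y} (h : p ≠ q) : ∃ y, p y < q y := by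
  by_contra! hle
  refine h (PMF.ext fun y => ?_)
  by_contra hy
  have := ENNReal.tsum_lt_tsum (f := q) (g := p) q.tsum_coe_ne_top hle
    (lt_of_le_of_ne (hle y) (Ne.symm hy))
  simp [PMF.tsum_coe] at this

theorem puncturedChannel_some {Y : Type*} (W : BDMC Y) {N : ℕ} {P : Pattern N} {j : Fin N}
    (hj : P j = false) (x : ZMod 2) (y : Y) : puncturedChannel W P j x (some y) = W x y := by
  simp only [puncturedChannel, hj, Bool.false_eq_true, if_false, PMF.map_apply]
  rw [tsum_eq_single y]
  · simp
  · intro y' hy'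
    simp [Ne.symm hy']

/-- For a nontrivial channel, every character of the input which is trivial at the punctured
positions is, up to a nonzero factor, the mean of a finitely supported function of the output. -/
theorem exists_test_function {Y : Type*} {W : BDMC Y} (hW : W 0 ≠ W 1) {N : ℕ} (P : Pattern N)
    (j : Fin N) (h : ZMod 2) (hP : P j = true → h = 0) :
    ∃ (S : Finset (Option Y)) (g : Option Y → ℝ) (β : ℝ), β ≠ 0 ∧
      ∀ x, ∑ z ∈ S, g z * (puncturedChannel W P j x z).toReal = β * sign (h * x) := by
  classical
  cases hj : P j
  -- Output `y₁` is likelier under input 0 and `y₂` under input 1, so their 2 × 2 matrix of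
  -- probabilities has positive determinant. The weights below come from Cramer's rule, with β that
  -- determinant.
  · obtain ⟨y₁, h₁⟩ := exists_lt_of_pmf_ne hW.symm
    obtain ⟨y₂, h₂⟩ := exists_lt_of_pmf_ne hW
    have h₁' := (ENNReal.toReal_lt_toReal ((W 1).apply_ne_top _) ((W 0).apply_ne_top _)).2 h₁
    have h₂' := (ENNReal.toReal_lt_toReal ((W 0).apply_ne_top _) ((W 1).apply_ne_top _)).2 h₂
    have hne : y₁ ≠ y₂ := by
      rintro rfl
      exact h₁.asymm h₂
    have hsum : ∀ (s t : ℝ) (x : ZMod 2), ∑ z ∈ {some y₁, some y₂},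
        (if z = some y₁ then s else t) * (puncturedChannel W P j x z).toReal =
          s * (W x y₁).toReal + t * (W x y₂).toReal := by
      intro s t x
      rw [Finset.sum_pair (by simpa using hne)]
      simp [puncturedChannel_some W hj, hne.symm]
    have p₁ : 0 ≤ (W 1 y₁).toReal := ENNReal.toReal_nonneg
    have p₂ : 0 ≤ (W 0 y₂).toReal := ENNReal.toReal_nonneg
    generalize ha0 : (W 0 y₁).toReal = a0 at *
    generalize ha1 : (W 1 y₁).toReal = a1 at *
    generalize hc0 : (W 0 y₂).toReal = c0 at *
    generalize hc1 : (W 1 y₂).toReal = c1 at *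
    have hβ : c0 * a1 < c1 * a0 := by nlinarith
    have two : ∀ x : ZMod 2, x = 0 ∨ x = 1 := by decide
    rcases two h with rfl | rfl
    · refine ⟨{some y₁, some y₂}, fun z => if z = some y₁ then c1 - c0 else a0 - a1,
        c1 * a0 - c0 * a1, by linarith, fun x => ?_⟩
      rw [hsum]
      rcases two x with rfl | rfl
      · rw [ha0, hc0, mul_zero, sign_zero]; ring
      · rw [ha1, hc1, zero_mul, sign_zero]; ring
    · refine ⟨{some y₁, some y₂}, fun z => if z = some y₁ then c0 + c1 else -(a0 + a1),
        c1 * a0 - c0 * a1, by linarith, fun x => ?_⟩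
      rw [hsum]
      rcases two x with rfl | rfl
      · rw [ha0, hc0, mul_zero, sign_zero]; ring
      · rw [ha1, hc1, mul_one, sign_one]; ring
  -- At a punctured position the output is surely ⋆ and the character is trivial.
  · refine ⟨{none}, fun _ => 1, 1, one_ne_zero, fun x => ?_⟩
    simp [puncturedChannel, hj, hP hj, sign_zero]

theorem productLaw_apply {Z : Type*} {N : ℕ} (p : Fin N → PMF Z) (z : Fin N → Z) :
    productLaw p z = ∏ j, p j (z j) := rfl

open Classical in
theorem virtualChannel_apply_toReal {Y : Type*} (W : BDMC Y) {n : ℕ} (P : Pattern (2 ^ n))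
    (i : Fin (2 ^ n)) (b : ZMod 2) (y : Fin (2 ^ n) → Option Y) (s : Fin i → ZMod 2) :
    (virtualChannel W P i b (y, s)).toReal =
      (Fintype.card (Fin (2 ^ n) → ZMod 2) : ℝ)⁻¹ * ∑ v : Fin (2 ^ n) → ZMod 2,
        if s = (fun k : Fin i => Function.update v i b ⟨k, k.isLt.trans i.isLt⟩) then
          ∏ j, (puncturedChannel W P j
            (Matrix.vecMul (Function.update v i b) (generatorMatrix n) j) (y j)).toReal
        else 0 := by
  have hmap : ∀ (p : PMF (Fin (2 ^ n) → Option Y)) (t : Fin i → ZMod 2),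
      (p.map fun y => (y, t)) (y, s) = if s = t then p y else 0 := by
    intro p t
    rw [PMF.map_apply, tsum_eq_single y]
    · simp
    · intro y' hy'
      simp [Ne.symm hy']
  simp only [virtualChannel, PMF.bind_apply, PMF.uniformOfFintype_apply, hmap, tsum_fintype]
  rw [← Finset.mul_sum, ENNReal.toReal_mul, ENNReal.toReal_inv, ENNReal.toReal_natCast,
    ENNReal.toReal_sum]
  · congr 1
    refine Finset.sum_congr rfl fun v _ => ?_
    split_ifs
    · rw [productLaw_apply, ENNReal.toReal_prod]
    · rfl
  · intro v _
    split_ifs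
    · exact PMF.apply_ne_top _ _
    · simp

/-- A position which is not erased is a known combination of earlier data bits and unpunctured
code symbols. -/
theorem exists_combination_of_not_isErased {n : ℕ} {P : Pattern (2 ^ n)} {i : Fin (2 ^ n)}
    (h : ¬ IsErased P i) :
    ∃ (c : Fin i → ZMod 2) (d : Fin (2 ^ n) → ZMod 2), (∀ j, P j = true → d j = 0) ∧
      ∀ u : Fin (2 ^ n) → ZMod 2, u i = ∑ k, c k * u ⟨k, k.isLt.trans i.isLt⟩ +
        ∑ j, d j * Matrix.vecMul u (generatorMatrix n) j := by
  let L : Fin i ⊕ Fin (2 ^ n) → (Fin (2 ^ n) → ZMod 2) →ₗ[ZMod 2] ZMod 2 :=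
    Sum.elim (fun k => LinearMap.proj ⟨k, k.isLt.trans i.isLt⟩)
      (fun j => if P j = false then LinearMap.proj j ∘ₗ (generatorMatrix n).vecMulLinear else 0)
  -- Duality: a form vanishing on the common kernel of finitely many forms lies in their span. A
  -- vector of that kernel with nonzero `i`-th entry would witness erasure.
  have hL : LinearMap.proj i ∈ Submodule.span (ZMod 2) (Set.range L) := by
    apply mem_span_of_iInf_ker_le_ker
    intro u hu
    rw [Submodule.mem_iInf] at hu
    simp only [LinearMap.mem_ker] at hu
    rw [LinearMap.mem_ker, LinearMap.proj_apply]
    by_contra hne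
    have two : ∀ x : ZMod 2, x ≠ 0 → x = 1 := by decide
    refine h ⟨u, fun k hk => hu (Sum.inl ⟨k, hk⟩), two _ hne, fun j hj => ?_⟩
    have := hu (Sum.inr j)
    simpa [L, hj] using this
  obtain ⟨c, hc⟩ := (Submodule.mem_span_range_iff_exists_fun (ZMod 2)).1 hL
  refine ⟨fun k => c (Sum.inl k), fun j => if P j = false then c (Sum.inr j) else 0,
    fun j hj => by simp [hj], fun u => ?_⟩
  have := LinearMap.congr_fun hc u
  rw [LinearMap.proj_apply, Fintype.sum_sum_type, LinearMap.add_apply, LinearMap.sum_apply,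
    LinearMap.sum_apply] at this
  rw [← this]
  congr 1
  refine Finset.sum_congr rfl fun j _ => ?_
  by_cases hj : P j = false <;> simp [L, hj]

/-- The character of the known combination, with each code symbol's character replaced by its test
function, has mean `(∏ j, β j) * sign b`, which depends on `b`. -/
theorem virtualChannel_ne_of_not_isErased {Y : Type*} {W : BDMC Y} (hW : W 0 ≠ W 1) {n : ℕ}
    {P : Pattern (2 ^ n)} {i : Fin (2 ^ n)} (h : ¬ IsErased P i) :
    virtualChannel W P i 0 ≠ virtualChannel W P i 1 := by
  classical
  obtain ⟨c, d, hd, hcd⟩ := exists_combination_of_not_isErased h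
  choose S g β hβ hg using fun j => exists_test_function hW P j (d j) (hd j)
  have key : ∀ b, ∑ s : Fin i → ZMod 2, sign (∑ k, c k * s k) *
      ∑ y ∈ Fintype.piFinset S, (∏ j, g j (y j)) * (virtualChannel W P i b (y, s)).toReal =
      (∏ j, β j) * sign b := by
    intro b
    have hv : ∀ v : Fin (2 ^ n) → ZMod 2,
        sign (∑ k, c k * Function.update v i b ⟨k, k.isLt.trans i.isLt⟩) *
          ∑ y ∈ Fintype.piFinset S, ∏ j, (g j (y j) * (puncturedChannel W P j
            (Matrix.vecMul (Function.update v i b) (generatorMatrix n) j) (y j)).toReal) =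
        (∏ j, β j) * sign b := by
      intro v
      rw [← Finset.prod_univ_sum S fun j z => g j z * (puncturedChannel W P j
        (Matrix.vecMul (Function.update v i b) (generatorMatrix n) j) z).toReal]
      simp only [hg]
      rw [Finset.prod_mul_distrib, ← sign_sum, mul_left_comm, ← sign_add, ← hcd,
        Function.update_self]
    have hcard : (Fintype.card (Fin (2 ^ n) → ZMod 2) : ℝ) ≠ 0 := by
      exact_mod_cast Fintype.card_ne_zero
    have havg : (∏ j, β j) * sign b = (Fintype.card (Fin (2 ^ n) → ZMod 2) : ℝ)⁻¹ *
        ∑ _v : Fin (2 ^ n) → ZMod 2, (∏ j, β j) * sign b := by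
      rw [Finset.sum_const, nsmul_eq_mul, Finset.card_univ, inv_mul_cancel_left₀ hcard]
    rw [havg]
    simp only [virtualChannel_apply_toReal, mul_left_comm _ (Fintype.card _ : ℝ)⁻¹,
      ← Finset.mul_sum]
    congr 1
    simp only [Finset.mul_sum]
    -- For each `v` only one `s` contributes, namely the bits of the updated data preceding `i`.
    calc _ = ∑ s : Fin i → ZMod 2, ∑ v : Fin (2 ^ n) → ZMod 2,
          if s = (fun k : Fin i => Function.update v i b ⟨k, k.isLt.trans i.isLt⟩) then
            (∏ j, β j) * sign b else 0 := by
          refine Finset.sum_congr rfl fun s _ => ?_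
          rw [Finset.sum_comm]
          refine Finset.sum_congr rfl fun v _ => ?_
          split_ifs with hs
          · rw [← hv v, hs, Finset.mul_sum]
            simp only [Finset.prod_mul_distrib]
          · simp
      _ = _ := by
          rw [Finset.sum_comm]
          simp
  intro heq
  have h0 := key 0
  rw [heq, key 1, sign_one, sign_zero] at h0
  have : ∏ j, β j ≠ 0 := Finset.prod_ne_zero_iff.2 fun j _ => hβ j
  exact this (by linarith)

theorem erasurePattern_iff {Y : Type*} {W : BDMC Y} (hW : 0 < symmetricCapacity W) {n : ℕ}
    (P : Pattern (2 ^ n)) (i : Fin (2 ^ n)) : erasurePattern W P i = true ↔ IsErased P i := by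
  have hne : W 0 ≠ W 1 := fun h => hW.ne' ((symmetricCapacity_eq_zero_iff W).2 h)
  rw [erasurePattern, decide_eq_true_iff, symmetricCapacity_eq_zero_iff]
  refine ⟨fun h => ?_, virtualChannel_eq_of_isErased W⟩
  by_contra hi
  exact virtualChannel_ne_of_not_isErased hne hi h

/-! ### Recursion on the most significant digit -/

theorem vecMul_blockEquiv (n : ℕ) (w : Fin (2 ^ (n + 1)) → ZMod 2) (b : Fin 2) (k : Fin (2 ^ n)) :
    Matrix.vecMul w (generatorMatrix (n + 1)) (blockEquiv n (b, k)) =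
      Matrix.vecMul (fun j => ∑ a, w (blockEquiv n (a, j)) * kernelMatrix a b)
        (generatorMatrix n) k := by
  simp only [Matrix.vecMul, dotProduct]
  rw [← (blockEquiv n).sum_comp, Fintype.sum_prod_type, Finset.sum_comm]
  refine Finset.sum_congr rfl fun j _ => ?_
  rw [Finset.sum_mul]
  refine Finset.sum_congr rfl fun a _ => ?_
  simp only [generatorMatrix, Matrix.reindex_apply, Matrix.submatrix_apply,
    Equiv.symm_apply_apply, Matrix.kronecker, Matrix.kroneckerMap_apply]
  ring

theorem vecMul_blockEquiv_zero (n : ℕ) (w : Fin (2 ^ (n + 1)) → ZMod 2) (k : Fin (2 ^ n)) :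
    Matrix.vecMul w (generatorMatrix (n + 1)) (blockEquiv n (0, k)) =
      Matrix.vecMul (fun j => w (blockEquiv n (0, j))) (generatorMatrix n) k +
      Matrix.vecMul (fun j => w (blockEquiv n (1, j))) (generatorMatrix n) k := by
  rw [vecMul_blockEquiv, ← Pi.add_apply, ← Matrix.add_vecMul]
  congr 2
  funext j
  simp [kernelMatrix]

theorem vecMul_blockEquiv_one (n : ℕ) (w : Fin (2 ^ (n + 1)) → ZMod 2) (k : Fin (2 ^ n)) :
    Matrix.vecMul w (generatorMatrix (n + 1)) (blockEquiv n (1, k)) =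
      Matrix.vecMul (fun j => w (blockEquiv n (1, j))) (generatorMatrix n) k := by
  rw [vecMul_blockEquiv]
  congr 2
  funext j
  simp [kernelMatrix]

/-- The block map (u₀, u₁) ↦ (u₀ + u₁, u₁) is inverted by subtraction. This allows a second half
with prescribed codeword in `isErased_blockEquiv_zero`. -/
theorem vecMul_generatorMatrix_surjective (n : ℕ) (x : Fin (2 ^ n) → ZMod 2) :
    ∃ u, Matrix.vecMul u (generatorMatrix n) = x := by
  induction n with
  | zero => exact ⟨x, by simp [generatorMatrix]⟩
  | succ n ih =>
    obtain ⟨u₀, h₀⟩ := ih fun k => x (blockEquiv n (0, k))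
    obtain ⟨u₁, h₁⟩ := ih fun k => x (blockEquiv n (1, k))
    refine ⟨fun i => (fun p : Fin 2 × Fin (2 ^ n) => if p.1 = 0 then u₀ p.2 - u₁ p.2 else u₁ p.2)
      ((blockEquiv n).symm i), ?_⟩
    funext i
    obtain ⟨⟨a, k⟩, rfl⟩ := (blockEquiv n).surjective i
    fin_cases a
    · refine (vecMul_blockEquiv_zero n _ k).trans ?_
      simp only [Equiv.symm_apply_apply]
      rw [← Pi.add_apply, ← Matrix.add_vecMul]
      refine Eq.trans ?_ (congrFun h₀ k)
      congr 2
      funext j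
      simp
    · refine (vecMul_blockEquiv_one n _ k).trans ?_
      simp only [Equiv.symm_apply_apply]
      exact congrFun h₁ k

theorem blockEquiv_val (n : ℕ) (a : Fin 2) (j : Fin (2 ^ n)) :
    (blockEquiv n (a, j) : ℕ) = j + 2 ^ n * a := rfl

theorem blockEquiv_zero_lt_one (n : ℕ) (j k : Fin (2 ^ n)) :
    blockEquiv n (0, j) < blockEquiv n (1, k) := by
  rw [Fin.lt_def, blockEquiv_val, blockEquiv_val]
  have := j.isLt
  simp only [Fin.val_zero, Fin.val_one]
  omega

theorem blockEquiv_lt_iff (n : ℕ) (a : Fin 2) (j k : Fin (2 ^ n)) :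
    blockEquiv n (a, j) < blockEquiv n (a, k) ↔ j < k := by
  rw [Fin.lt_def, blockEquiv_val, blockEquiv_val, Fin.lt_def]
  omega

/-- The first half of `w` is zero, so both halves of the codeword coincide and must vanish wherever
either copy is unpunctured. -/
theorem isErased_blockEquiv_one {n : ℕ} (P : Pattern (2 ^ (n + 1))) (i : Fin (2 ^ n)) :
    IsErased P (blockEquiv n (1, i)) ↔
      IsErased (fun k => P (blockEquiv n (0, k)) && P (blockEquiv n (1, k))) i := by
  constructor
  · rintro ⟨w, h1, h2, h3⟩
    refine ⟨fun j => w (blockEquiv n (1, j)), fun k hk => h1 _ ((blockEquiv_lt_iff n 1 k i).2 hk),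
      h2, fun j hj => ?_⟩
    have hz : (fun j => w (blockEquiv n (0, j))) = 0 :=
      funext fun j => h1 _ (blockEquiv_zero_lt_one n j i)
    rcases Bool.and_eq_false_iff.1 hj with hj | hj
    · have := h3 _ hj
      rwa [vecMul_blockEquiv_zero, hz, Matrix.zero_vecMul, Pi.zero_apply, zero_add] at this
    · have := h3 _ hj
      rwa [vecMul_blockEquiv_one] at this
  · rintro ⟨w, h1, h2, h3⟩
    let u : Fin (2 ^ (n + 1)) → ZMod 2 := fun i =>
      (fun p : Fin 2 × Fin (2 ^ n) => if p.1 = 0 then 0 else w p.2) ((blockEquiv n).symm i)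
    have hu0 : ∀ j, u (blockEquiv n (0, j)) = 0 := fun j => by simp [u]
    have hu1 : ∀ j, u (blockEquiv n (1, j)) = w j := fun j => by simp [u]
    refine ⟨u, fun k hk => ?_, (hu1 i).trans h2, fun j hj => ?_⟩
    · obtain ⟨⟨a, k⟩, rfl⟩ := (blockEquiv n).surjective k
      fin_cases a
      · exact hu0 k
      · exact (hu1 k).trans (h1 k ((blockEquiv_lt_iff n 1 k i).1 hk))
    · obtain ⟨⟨a, k⟩, rfl⟩ := (blockEquiv n).surjective j
      fin_cases a
      · refine (vecMul_blockEquiv_zero n u k).trans ?_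
        simp only [hu0, hu1]
        have := h3 k (by simp at hj; simp [hj])
        rw [this, add_zero]
        exact congrFun (Matrix.zero_vecMul _) k
      · refine (vecMul_blockEquiv_one n u k).trans ?_
        simp only [hu1]
        exact h3 k (by simp at hj; simp [hj])

/-- The second half of `w` is free, since it lies after the leading position; the first half is
constrained only where both copies are unpunctured. -/
theorem isErased_blockEquiv_zero {n : ℕ} (P : Pattern (2 ^ (n + 1))) (i : Fin (2 ^ n)) :
    IsErased P (blockEquiv n (0, i)) ↔
      IsErased (fun k => P (blockEquiv n (0, k)) || P (blockEquiv n (1, k))) i := by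
  constructor
  · rintro ⟨w, h1, h2, h3⟩
    refine ⟨fun j => w (blockEquiv n (0, j)), fun k hk => h1 _ ((blockEquiv_lt_iff n 0 k i).2 hk),
      h2, fun j hj => ?_⟩
    obtain ⟨hj0, hj1⟩ := Bool.or_eq_false_iff.1 hj
    have e0 := h3 _ hj0
    have e1 := h3 _ hj1
    rw [vecMul_blockEquiv_zero] at e0
    rw [vecMul_blockEquiv_one] at e1
    rwa [e1, add_zero] at e0
  · rintro ⟨w, h1, h2, h3⟩
    -- The codeword of `w₁` cancels that of `w` where the second copy is punctured, and is zero
    -- where it must be.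
    obtain ⟨w₁, hw₁⟩ := vecMul_generatorMatrix_surjective n fun k =>
      if P (blockEquiv n (1, k)) = true then
        -Matrix.vecMul w (generatorMatrix n) k else 0
    let u : Fin (2 ^ (n + 1)) → ZMod 2 := fun i =>
      (fun p : Fin 2 × Fin (2 ^ n) => if p.1 = 0 then w p.2 else w₁ p.2) ((blockEquiv n).symm i)
    have hu0 : ∀ j, u (blockEquiv n (0, j)) = w j := fun j => by simp [u]
    have hu1 : ∀ j, u (blockEquiv n (1, j)) = w₁ j := fun j => by simp [u]
    refine ⟨u, fun k hk => ?_, (hu0 i).trans h2, fun j hj => ?_⟩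
    · obtain ⟨⟨a, k⟩, rfl⟩ := (blockEquiv n).surjective k
      fin_cases a
      · exact (hu0 k).trans (h1 k ((blockEquiv_lt_iff n 0 k i).1 hk))
      · exact absurd hk (blockEquiv_zero_lt_one n i k).asymm
    · obtain ⟨⟨a, k⟩, rfl⟩ := (blockEquiv n).surjective j
      fin_cases a
      · refine (vecMul_blockEquiv_zero n u k).trans ?_
        simp only [hu0, hu1, hw₁]
        split_ifs with h
        · exact add_neg_cancel _
        · rw [add_zero]
          exact h3 k (by simp at hj; simpa [hj] using h)
      · refine (vecMul_blockEquiv_one n u k).trans ?_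
        simp only [hu1, hw₁]
        exact if_neg (by simp at hj; simp [hj])

theorem isErased_zero (P : Pattern (2 ^ 0)) (i : Fin (2 ^ 0)) : IsErased P i ↔ P i = true := by
  have hsub : ∀ a b : Fin (2 ^ 0), a = b := fun a b => Subsingleton.elim (α := Fin 1) a b
  constructor
  · rintro ⟨w, -, h2, h3⟩
    by_contra h
    have := h3 i (by simpa using h)
    rw [generatorMatrix, Matrix.vecMul_one, h2] at this
    exact one_ne_zero this
  · intro h
    refine ⟨fun _ => 1, fun k hk => absurd (hsub k i) hk.ne, rfl, fun j hj => ?_⟩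
    rw [hsub j i, h] at hj
    exact absurd hj (by simp)

/-! ### Recursion on the least significant digit -/

/-- The index `2 * i + b`. -/
def interleave {n : ℕ} (b : Fin 2) (i : Fin (2 ^ n)) : Fin (2 ^ (n + 1)) :=
  ⟨2 * i + b, by have := i.isLt; have := b.isLt; rw [pow_succ]; omega⟩

theorem interleave_blockEquiv (n : ℕ) (a b : Fin 2) (i : Fin (2 ^ n)) :
    interleave b (blockEquiv n (a, i)) = blockEquiv (n + 1) (a, interleave b i) := by
  apply Fin.ext
  simp only [interleave, blockEquiv_val, pow_succ]
  ring

/-- Splits on the most and the least significant digit commute, so the induction peels off the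
former, replacing `P` by the OR or AND of its halves. At length 2 the two splits coincide. -/
theorem isErased_interleave {n : ℕ} (P : Pattern (2 ^ (n + 1))) (i : Fin (2 ^ n)) :
    (IsErased P (interleave 0 i) ↔
      IsErased (fun k => P (interleave 0 k)) i ∨ IsErased (fun k => P (interleave 1 k)) i) ∧
    (IsErased P (interleave 1 i) ↔
      IsErased (fun k => P (interleave 0 k)) i ∧ IsErased (fun k => P (interleave 1 k)) i) := by
  induction n with
  | zero =>
    have h : ∀ b, interleave b i = blockEquiv 0 (b, i) := by
      intro b
      apply Fin.ext
      have hi : (i : ℕ) = 0 := by have := i.isLt; simp at this; omega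
      rw [blockEquiv_val]
      simp only [interleave, hi]
      omega
    rw [h, h, isErased_blockEquiv_zero, isErased_blockEquiv_one]
    simp only [isErased_zero, h, Bool.or_eq_true, Bool.and_eq_true, and_self]
  | succ n ih =>
    obtain ⟨⟨a, i⟩, rfl⟩ := (blockEquiv n).surjective i
    fin_cases a
    · change (IsErased P (interleave 0 (blockEquiv n (0, i))) ↔
        IsErased _ (blockEquiv n (0, i)) ∨ IsErased _ (blockEquiv n (0, i))) ∧
        (IsErased P (interleave 1 (blockEquiv n (0, i))) ↔
        IsErased _ (blockEquiv n (0, i)) ∧ IsErased _ (blockEquiv n (0, i)))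
      simp only [interleave_blockEquiv, isErased_blockEquiv_zero]
      exact ih _ i
    · change (IsErased P (interleave 0 (blockEquiv n (1, i))) ↔
        IsErased _ (blockEquiv n (1, i)) ∨ IsErased _ (blockEquiv n (1, i))) ∧
        (IsErased P (interleave 1 (blockEquiv n (1, i))) ↔
        IsErased _ (blockEquiv n (1, i)) ∧ IsErased _ (blockEquiv n (1, i)))
      simp only [interleave_blockEquiv, isErased_blockEquiv_one]
      exact ih _ i

theorem exists_interleave {n : ℕ} (j : Fin (2 ^ (n + 1))) :
    ∃ (b : Fin 2) (i : Fin (2 ^ n)), j = interleave b i := by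
  refine ⟨⟨j % 2, Nat.mod_lt _ two_pos⟩, ⟨j / 2, ?_⟩, Fin.ext ?_⟩
  · have := j.isLt.trans_eq (pow_succ 2 n)
    omega
  · simp only [interleave]
    omega

/-! ### Bit reversal -/

theorem finFunctionFinEquiv_cons {n : ℕ} (b : Fin 2) (d : Fin n → Fin 2) :
    finFunctionFinEquiv (Fin.cons b d : Fin (n + 1) → Fin 2) =
      interleave b (finFunctionFinEquiv d) := by
  apply Fin.ext
  simp only [interleave, finFunctionFinEquiv_apply, Fin.sum_univ_succ, Fin.cons_zero,
    Fin.cons_succ, Fin.val_zero, pow_zero, mul_one, Fin.val_succ, pow_succ, Finset.mul_sum]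
  rw [add_comm]
  congr 1
  exact Finset.sum_congr rfl fun k _ => by ring

theorem finFunctionFinEquiv_snoc_val {n : ℕ} (b : Fin 2) (d : Fin n → Fin 2) :
    (finFunctionFinEquiv (Fin.snoc d b : Fin (n + 1) → Fin 2) : ℕ) =
      2 ^ n * b + finFunctionFinEquiv d := by
  simp only [finFunctionFinEquiv_apply, Fin.sum_univ_castSucc, Fin.snoc_castSucc, Fin.snoc_last,
    Fin.val_castSucc, Fin.val_last]
  ring

theorem bitReversal_finFunctionFinEquiv {n : ℕ} (d : Fin n → Fin 2) :
    bitReversal n (finFunctionFinEquiv d) = finFunctionFinEquiv fun k => d k.rev := by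
  simp only [bitReversal, Equiv.trans_apply, Equiv.symm_apply_apply]
  rfl

/-- Reversal sends the top digit `b` to the bottom, and the reversal of the remaining digits undoes
the one already applied to `i`. -/
theorem bitReversal_succ {n : ℕ} (b : Fin 2) (i : Fin (2 ^ n)) (j : Fin (2 ^ (n + 1)))
    (hj : (j : ℕ) = 2 ^ n * b + bitReversal n i) : bitReversal (n + 1) j = interleave b i := by
  obtain ⟨d, rfl⟩ := finFunctionFinEquiv.surjective i
  have : j = finFunctionFinEquiv (Fin.snoc (fun k => d k.rev) b : Fin (n + 1) → Fin 2) := by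
    apply Fin.ext
    rw [hj, bitReversal_finFunctionFinEquiv, finFunctionFinEquiv_snoc_val]
  rw [this, bitReversal_finFunctionFinEquiv, ← finFunctionFinEquiv_cons]
  congr 1
  funext k
  refine Fin.cases ?_ (fun k => ?_) k
  · simp
  · rw [Fin.rev_succ, Fin.snoc_castSucc, Fin.rev_rev, Fin.cons_succ]

/-- A fixed top digit before reversal is a fixed bottom digit after it, so the two halves become the
even and odd parts. -/
theorem permute_firstHalf {n : ℕ} (P : Pattern (2 ^ (n + 1))) :
    permute (bitReversal n) (firstHalf (permute (bitReversal (n + 1)) P)) =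
      fun i => P (interleave 0 i) := by
  funext i
  simp only [permute, firstHalf]
  rw [bitReversal_succ 0 i _ (by simp)]

theorem permute_secondHalf {n : ℕ} (P : Pattern (2 ^ (n + 1))) :
    permute (bitReversal n) (secondHalf (permute (bitReversal (n + 1)) P)) =
      fun i => P (interleave 1 i) := by
  funext i
  simp only [permute, secondHalf]
  rw [bitReversal_succ 1 i _ (by simp)]

/-! ### Inclusion and symmetry of patterns -/

theorem bitIncluded_iff {N : ℕ} (A B : Pattern N) :
    BitIncluded A B ↔ ∀ i, A i = true → B i = true := by
  rw [BitIncluded, funext_iff]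
  refine forall_congr' fun i => ?_
  cases A i <;> cases B i <;> simp

theorem bitIncluded_permute_iff {N : ℕ} (φ : Equiv.Perm (Fin N)) (A B : Pattern N) :
    BitIncluded (permute φ A) (permute φ B) ↔ BitIncluded A B := by
  simp only [bitIncluded_iff, permute]
  exact φ.surjective.forall (p := fun i => A i = true → B i = true) |>.symm

theorem isSymmetricPattern_iff {Y : Type*} {W : BDMC Y} (hW : 0 < symmetricCapacity W) {n : ℕ}
    (P : Pattern (2 ^ n)) : IsSymmetricPattern W P ↔ ∀ i, IsErased P i ↔ P i = true := by
  rw [IsSymmetricPattern, funext_iff]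
  refine forall_congr' fun i => ?_
  rw [← erasurePattern_iff hW, Bool.eq_iff_iff]

/-- A pattern is symmetric iff its even and odd parts are, and the odd part is contained in the
even part. -/
theorem isErased_iff_self_iff_interleave {n : ℕ} (P : Pattern (2 ^ (n + 1))) :
    (∀ i, IsErased P i ↔ P i = true) ↔
      (∀ i, IsErased (fun k => P (interleave 0 k)) i ↔ P (interleave 0 i) = true) ∧
      (∀ i, IsErased (fun k => P (interleave 1 k)) i ↔ P (interleave 1 i) = true) ∧
      ∀ i, P (interleave 1 i) = true → P (interleave 0 i) = true := by
  constructor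
  · intro h
    have hsub : ∀ i, P (interleave 1 i) = true → P (interleave 0 i) = true := by
      intro i hi
      rw [← h, (isErased_interleave P i).1]
      rw [← h, (isErased_interleave P i).2] at hi
      exact Or.inl hi.1
    have hmono : ∀ i, IsErased (fun k => P (interleave 1 k)) i →
        IsErased (fun k => P (interleave 0 k)) i := fun i => IsErased.mono hsub
    -- The nested erasures collapse OR to the even part and AND to the odd part.
    refine ⟨fun i => ?_, fun i => ?_, hsub⟩
    · rw [← h, (isErased_interleave P i).1]
      exact ⟨Or.inl, fun h => h.elim id (hmono i)⟩
    · rw [← h, (isErased_interleave P i).2]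
      exact ⟨fun h => ⟨hmono i h, h⟩, And.right⟩
  · rintro ⟨h0, h1, hsub⟩ j
    obtain ⟨b, i, rfl⟩ := exists_interleave j
    fin_cases b
    · refine (isErased_interleave P i).1.trans ?_
      rw [h0, h1]
      exact ⟨fun h => h.elim id (hsub i), Or.inl⟩
    · refine (isErased_interleave P i).2.trans ?_
      rw [h0, h1]
      exact ⟨And.right, fun h => ⟨hsub i h, h⟩⟩

end PolarPuncturing

theorem mainTheorem7 {Y : Type*} (W : BDMC Y) (hW : 0 < symmetricCapacity W) (n : ℕ)
    (P Pbar : Pattern (2 ^ (n + 1))) (hPbar : Pbar = permute (bitReversal (n + 1)) P) :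
    IsSymmetricPattern W P ↔
      IsSymmetricPattern W (permute (bitReversal n) (firstHalf Pbar)) ∧
      IsSymmetricPattern W (permute (bitReversal n) (secondHalf Pbar)) ∧
      BitIncluded (secondHalf Pbar) (firstHalf Pbar) := by
  subst hPbar
  -- Permuting both sides of the inclusion brings it to the same even and odd parts as the symmetry
  -- conditions.
  rw [← bitIncluded_permute_iff (bitReversal n), permute_firstHalf, permute_secondHalf,
    bitIncluded_iff, isSymmetricPattern_iff hW, isSymmetricPattern_iff hW,
    isSymmetricPattern_iff hW]
  exact isErased_iff_self_iff_interleave P
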